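/- Let $\Theta$ be a finite set of states and $A$ a finite set of actions with $|A|\ge 4$, and let $u(a)\in\mathbb{R}^{\Theta}$ be the task payoff vector of $a\in A$. A belief is a probability vector $p$ on $\Theta$, and $\mathbb{E}_p v=\sum_\theta p(\theta)v(\theta)$; an action is optimal under $p$ if it maximizes $\mathbb{E}_p u(a)$ over $a\in A$. For $v\in\mathbb{R}^\Theta$ let $\bar v=v-\frac{1}{|\Theta|}\sum_{\theta}v(\theta)\mathbf{1}$, where $\mathbf 1\in\mathbb{R}^\Theta$ is the all-ones vector, and let $\Delta_a^b=\bar u(b)-\bar u(a)$. A (single) question is a family $X=(X(a))_{a\in A}$ of vectors $X(a)\in\mathbb{R}^\Theta$. - $X$ is incentivizable if there is $V:\mathbb{R}\times A\times\Theta\to[0,1]$ such that for every belief $p$, $\arg\max_{(r,a)\in\mathbb{R}\times A}\mathbb{E}_p[V(r,a,\theta)]=\{(\mathbb{E}_pX(a),a): a\in\arg\max_{a'\in A}\mathbb{E}_pu(a')\}$. - $X$ is robustly incentivizable if there are nonzero reals $\mu(a)$, $a\in A$, such that for every $t\in\mathbb{R}^{\Theta}$ the question $X_t(a)=X(a)+\mu(a)t$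 is incentivizable. - $X$ is aligned with $u$ if there are $\lambda\in\mathbb{R}$, $d\in\mathbb{R}^\Theta$ and, for each $a\in A$, reals $\gamma(a)\ne0$ and $\kappa(a)$ such that $X(a)=\gamma(a)(\lambda u(a)+d)+\kappa(a)\mathbf{1}$ for all $a\in A$. Two distinct actions are adjacent if there is a belief under which both are optimal and no other action is; the adjacency graph is the graph on $A$ with these edges. Suppose that (i) the adjacency graph is complete, and (ii) for any four distinct actions $a,b_0,b_1,b_2$, the vectors $\Delta_a^{b_0},\Delta_a^{b_1},\Delta_a^{b_2}$ are linearly independent. Then a question $X$ is robustly incentivizable if and only if it is aligned with $u$. -/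

import Mathlib

open scoped Matrix

/-- The expectation `𝔼_p v` of a state-contingent vector `v` under the belief `p`. -/
def expect {Θ : Type*} [Fintype Θ] (p v : Θ → ℝ) : ℝ :=
  ∑ θ, p θ * v θ

/-- The actions that maximize the expected task payoff under the belief `p`. -/
def optimalActions {A Θ : Type*} [Fintype Θ] (u : A → Θ → ℝ) (p : Θ → ℝ) : Set A :=
  {a | ∀ b, expect p (u b) ≤ expect p (u a)}

/-- The truthful report `𝔼_p X(a)` to an `m`-dimensional question profile at the action `a`;
the row `j` of the matrix `X a` is the question `X_j(a)`. -/
def truthfulReport {A Θ : Type*} [Fintype Θ] {m : ℕ} (X : A → Matrix (Fin m) Θ ℝ)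
    (p : Θ → ℝ) (a : A) : Fin m → ℝ :=
  fun j => expect p (X a j)

/-- The pairs (report, action) that maximize the expected payment under the belief `p`,
over all reports and all actions. -/
def optimalResponses {A Θ : Type*} [Fintype Θ] {m : ℕ} (V : (Fin m → ℝ) → A → Θ → ℝ)
    (p : Θ → ℝ) : Set ((Fin m → ℝ) × A) :=
  {x | ∀ y : (Fin m → ℝ) × A, expect p (V y.1 y.2) ≤ expect p (V x.1 x.2)}

/-- `X` is incentivizable: for some elicitation method with values in `[0, 1]`, under every belief
the optimal responses are exactly the truthful report together with an optimal task action. -/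
def IsIncentivizable {A Θ : Type*} [Fintype Θ] {m : ℕ} (u : A → Θ → ℝ)
    (X : A → Matrix (Fin m) Θ ℝ) : Prop :=
  ∃ V : (Fin m → ℝ) → A → Θ → ℝ,
    (∀ r a θ, V r a θ ∈ Set.Icc (0 : ℝ) 1) ∧
    ∀ p ∈ stdSimplex ℝ Θ,
      optimalResponses V p = {x | x.2 ∈ optimalActions u p ∧ x.1 = truthfulReport X p x.2}

/-- `X` is robustly (jointly) incentivizable. -/
def IsRobustlyIncentivizable {A Θ : Type*} [Fintype Θ] {m : ℕ} (u : A → Θ → ℝ)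
    (X : A → Matrix (Fin m) Θ ℝ) : Prop :=
  ∃ μ : A → Matrix (Fin m) (Fin m) ℝ, (∀ a, IsUnit (μ a)) ∧
    ∀ t : Matrix (Fin m) Θ ℝ, IsIncentivizable u (fun a => X a + μ a * t)

/-- `X` is (jointly) aligned with `u`: `X(a) = Γ(a) (l u(a) + d) + κ(a) 𝟏`, where `l` and `κ(a)` are
column vectors and `u(a)` and `𝟏` are row vectors. -/
def IsAligned {A Θ : Type*} {m : ℕ} (u : A → Θ → ℝ)
    (X : A → Matrix (Fin m) Θ ℝ) : Prop :=
  ∃ (l : Fin m → ℝ) (d : Matrix (Fin m) Θ ℝ) (Γ : A → Matrix (Fin m) (Fin m) ℝ)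
    (κ : A → Fin m → ℝ),
    ∀ a, IsUnit (Γ a) ∧
      X a = Γ a * (Matrix.vecMulVec l (u a) + d) + Matrix.vecMulVec (κ a) (fun _ => 1)

/-- Two distinct actions are adjacent if under some belief they are both optimal and no other
action is. -/
def adjacencyGraph {A Θ : Type*} [Fintype Θ] (u : A → Θ → ℝ) : SimpleGraph A where
  Adj a b := a ≠ b ∧ ∃ p ∈ stdSimplex ℝ Θ, optimalActions u p = {a, b}
  symm := ⟨fun a b h => by
    obtain ⟨hab, p, hp, h⟩ := h
    exact ⟨hab.symm, p, hp, by rw [h, Set.pair_comm]⟩⟩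
  loopless := ⟨fun a h => h.1 rfl⟩

/-- `v` minus its average over the states. -/
noncomputable def centered {Θ : Type*} [Fintype Θ] (v : Θ → ℝ) : Θ → ℝ :=
  fun θ => v θ - (∑ θ', v θ') / (Fintype.card Θ : ℝ)

/-- The payoff difference vector `Δ_a^b`. -/
noncomputable def payoffDiff {A Θ : Type*} [Fintype Θ] (u : A → Θ → ℝ) (a b : A) : Θ → ℝ :=
  centered (u b) - centered (u a)

/-! Sufficiency: after undoing `γ(a)` and `κ(a)`, every action asks about `w(a) = l u(a) + d`. A
quadratic score plus a large multiple of `u` makes truth optimal and the best payoff at `a` strictly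
increasing in the expectation of `u(a)` (`isIncentivizable_of_eq_smul_add`); a shift by `t` only
changes `d`.

Necessity: suppose `a` and `b` stay optimal along a segment of beliefs. If the answer at `b` is
constant there, so is the answer at `a` (`truthfulReport_eq_of_isIncentivizable`). A shift `t` makes
the question at `b` vanish. Adjacency supplies segments in every direction orthogonal to `𝟏` and
`u(b) - u(a)`, so `X(b)/μ(b) - X(a)/μ(a)` equals a multiple of `u(b) - u(a)` plus a constant. Adding
these relations around a triangle of actions, linear independence forces one common multiple `l`,
which is alignment. -/

section Expectation

variable {Θ : Type*} [Fintype Θ]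

theorem expect_eq_dotProduct (p v : Θ → ℝ) : expect p v = p ⬝ᵥ v := rfl

theorem continuous_expect_left (v : Θ → ℝ) : Continuous fun p : Θ → ℝ => expect p v := by
  unfold expect
  fun_prop

theorem expect_const_of_mem {p : Θ → ℝ} (hp : p ∈ stdSimplex ℝ Θ) (c : ℝ) :
    expect p (fun _ => c) = c := by
  rw [expect, ← Finset.sum_mul, hp.2, one_mul]

theorem abs_expect_le {p : Θ → ℝ} (hp : p ∈ stdSimplex ℝ Θ) {v : Θ → ℝ} {B : ℝ}
    (hv : ∀ θ, |v θ| ≤ B) : |expect p v| ≤ B := by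
  calc |expect p v| ≤ ∑ θ, |p θ * v θ| := Finset.abs_sum_le_sum_abs _ _
    _ ≤ ∑ θ, p θ * B := Finset.sum_le_sum fun θ _ => by
        rw [abs_mul, abs_of_nonneg (hp.1 θ)]
        exact mul_le_mul_of_nonneg_left (hv θ) (hp.1 θ)
    _ = B := expect_const_of_mem hp B

/-- A vector annihilating everything that `𝟏` and `D` annihilate is a combination of the two. -/
theorem exists_eq_const_add_smul {y D : Θ → ℝ}
    (h : ∀ e : Θ → ℝ, ∑ θ, e θ = 0 → expect e D = 0 → expect e y = 0) :
    ∃ k l : ℝ, ∀ θ, y θ = k + l * D θ := by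
  classical
  let L : (Θ → ℝ) → (Θ → ℝ) →ₗ[ℝ] ℝ := fun v => Fintype.linearCombination ℝ v
  have hL : ∀ v e, L v e = expect e v := fun v e => by
    simp [L, Fintype.linearCombination_apply, expect]
  have hmem : L y ∈ Submodule.span ℝ (Set.range ![L (fun _ => 1), L D]) := by
    refine mem_span_of_iInf_ker_le_ker fun e he => ?_
    rw [Submodule.mem_iInf] at he
    have h0 : L (fun _ => 1) e = 0 := he 0
    have h1 : L D e = 0 := he 1
    rw [hL] at h0 h1
    rw [LinearMap.mem_ker, hL]
    exact h e (by simpa [expect] using h0) h1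
  rw [Matrix.range_cons, Matrix.range_cons, Matrix.range_empty, Set.union_empty,
    Set.singleton_union, Submodule.mem_span_pair] at hmem
  obtain ⟨k, l, hkl⟩ := hmem
  refine ⟨k, l, fun θ => ?_⟩
  have := congrArg (fun f => f (Pi.single θ 1)) hkl
  simpa [hL, expect, Pi.single_apply] using this.symm

end Expectation

/-! ### Aligned questions: quadratic scoring -/

section Sufficiency

variable {A Θ : Type*} [Fintype Θ]

/-- The quadratic scoring payment for a question `γ(a) (l u(a) + d) + κ(a) 𝟏`, normalized to take
values in `[0, 1]` and vanishing at reports that no belief makes truthful. -/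
noncomputable def quadraticScore (u w : A → Θ → ℝ) (γ κ : A → ℝ) (B c K : ℝ)
    (r : Fin 1 → ℝ) (a : A) (θ : Θ) : ℝ :=
  if |(r 0 - κ a) / γ a| ≤ B then
    (2 * ((r 0 - κ a) / γ a) * w a θ - ((r 0 - κ a) / γ a) ^ 2 + c * u a θ + K) / (2 * K)
  else 0

theorem expect_quadraticScore {u w : A → Θ → ℝ} {γ κ : A → ℝ} {B c K : ℝ} {p : Θ → ℝ}
    (hp : p ∈ stdSimplex ℝ Θ) {r : Fin 1 → ℝ} {a : A} (h : |(r 0 - κ a) / γ a| ≤ B) :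
    expect p (quadraticScore u w γ κ B c K r a) =
      (expect p (w a) ^ 2 + c * expect p (u a)
        - ((r 0 - κ a) / γ a - expect p (w a)) ^ 2 + K) / (2 * K) := by
  set s := (r 0 - κ a) / γ a with hs
  have h1 : quadraticScore u w γ κ B c K r a =
      (2 * K)⁻¹ • ((2 * s) • w a + c • u a + fun _ => K - s ^ 2) := by
    ext θ
    simp only [quadraticScore, ← hs, if_pos h, Pi.smul_apply, Pi.add_apply, smul_eq_mul]
    ring
  have h2 := expect_const_of_mem hp (K - s ^ 2)
  rw [expect_eq_dotProduct] at h2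
  rw [h1, expect_eq_dotProduct, dotProduct_smul, dotProduct_add, dotProduct_add, dotProduct_smul,
    dotProduct_smul, h2]
  simp only [expect_eq_dotProduct, smul_eq_mul]
  ring

theorem exists_abs_le [Finite A] (w : A → Θ → ℝ) : ∃ B : ℝ, 0 ≤ B ∧ ∀ a θ, |w a θ| ≤ B := by
  obtain ⟨B, hB⟩ := (Set.finite_range fun x : A × Θ => |w x.1 x.2|).bddAbove
  exact ⟨max B 0, le_max_right _ _, fun a θ => (hB ⟨(a, θ), rfl⟩).trans (le_max_left _ _)⟩

theorem exists_mem_optimalActions [Finite A] [Nonempty A] (u : A → Θ → ℝ) (p : Θ → ℝ) :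
    ∃ a, a ∈ optimalActions u p :=
  Finite.exists_max fun a => expect p (u a)

/-- Up to normalization the best payoff at `a` is `(𝔼 w(a))² + c 𝔼 u(a)`. As `𝔼 w(a) - l 𝔼 u(a)`
does not depend on `a`, differences between actions factor through those of `𝔼 u`, and a large `c`
fixes the sign. -/
theorem isIncentivizable_of_eq_smul_add [Finite A] [Nonempty A] {u : A → Θ → ℝ} {X : A → Matrix (Fin 1) Θ ℝ}
    {l : ℝ} {d : Θ → ℝ} {γ κ : A → ℝ} (hγ : ∀ a, γ a ≠ 0)
    (hX : ∀ a θ, X a 0 θ = γ a * (l * u a θ + d θ) + κ a) : IsIncentivizable u X := by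
  set w : A → Θ → ℝ := fun a => l • u a + d with hw
  obtain ⟨B, hB0, hB⟩ := exists_abs_le w
  obtain ⟨U, hU0, hU⟩ := exists_abs_le u
  -- Dominates `l (𝔼 w(a) + 𝔼 w(b))`, so that the slope in `hval_mono` is at least 1.
  set c := 2 * |l| * B + 1 with hc
  have hc0 : 0 ≤ c := by positivity
  -- Strictly exceeds the raw score in absolute value. Hence truthful reports earn a positive
  -- amount, and reports paid 0 are strictly worse.
  set K := 3 * B ^ 2 + c * U + 1 with hK
  have hK0 : 0 < K := by positivity
  have hraw : ∀ (s : ℝ) a θ, |s| ≤ B → |2 * s * w a θ - s ^ 2 + c * u a θ| < K := by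
    intro s a θ hs
    have h1 : |s * w a θ| ≤ B * B := by
      rw [abs_mul]; exact mul_le_mul hs (hB a θ) (abs_nonneg _) hB0
    have h2 : s ^ 2 ≤ B ^ 2 := sq_le_sq' (abs_le.1 hs).1 (abs_le.1 hs).2
    have h3 : |c * u a θ| ≤ c * U := by
      rw [abs_mul, abs_of_nonneg hc0]; exact mul_le_mul_of_nonneg_left (hU a θ) hc0
    rw [abs_le] at h1 h3
    rw [abs_lt]
    constructor <;> nlinarith [sq_nonneg s]
  refine ⟨quadraticScore u w γ κ B c K, fun r a θ => ?_, fun p hp => ?_⟩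
  · unfold quadraticScore
    split_ifs with h
    · have := abs_lt.1 (hraw _ a θ h)
      exact ⟨div_nonneg (by linarith) (by linarith), (div_le_one (by linarith)).2 (by linarith)⟩
    · simp
  have hwp : ∀ a, expect p (w a) = l * expect p (u a) + expect p d := fun a => by
    simp [hw, expect_eq_dotProduct]
  have htruth : ∀ a, truthfulReport X p a = fun _ => γ a * expect p (w a) + κ a := fun a => by
    funext j
    have h1 : X a 0 = γ a • w a + fun _ => κ a := by
      ext θ; simp [hX, hw, mul_add]
    have h2 := expect_const_of_mem hp (κ a)
    rw [expect_eq_dotProduct] at h2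
    rw [truthfulReport, Subsingleton.elim j 0, h1, expect_eq_dotProduct, dotProduct_add, h2,
      dotProduct_smul, smul_eq_mul, expect_eq_dotProduct]
  have hwB : ∀ a, |expect p (w a)| ≤ B := fun a => abs_expect_le hp (hB a)
  have hvU : ∀ a, |expect p (u a)| ≤ U := fun a => abs_expect_le hp (hU a)
  set val : A → ℝ := fun a => (expect p (w a) ^ 2 + c * expect p (u a) + K) / (2 * K) with hval
  have hval_truth : ∀ a, expect p (quadraticScore u w γ κ B c K (truthfulReport X p a) a) =
      val a := fun a => by
    have h1 : (truthfulReport X p a 0 - κ a) / γ a = expect p (w a) := by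
      rw [htruth, add_sub_cancel_right, mul_div_cancel_left₀ _ (hγ a)]
    rw [expect_quadraticScore hp (by rw [h1]; exact hwB a), h1]
    simp [hval]
  have hval_lt : ∀ r a, r ≠ truthfulReport X p a →
      expect p (quadraticScore u w γ κ B c K r a) < val a := fun r a hr => by
    by_cases h : |(r 0 - κ a) / γ a| ≤ B
    · rw [expect_quadraticScore hp h]
      have hne : (r 0 - κ a) / γ a - expect p (w a) ≠ 0 := fun h0 => hr <| by
        rw [htruth]
        funext j
        rw [Subsingleton.elim j 0]
        have := (div_eq_iff (hγ a)).1 (sub_eq_zero.1 h0)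
        linarith
      have hpos := sq_pos_of_ne_zero hne
      exact div_lt_div_of_pos_right (by linarith) (by linarith)
    · have h0 : quadraticScore u w γ κ B c K r a = 0 := by
        funext θ; simp [quadraticScore, h]
      rw [h0, expect_eq_dotProduct, dotProduct_zero]
      refine div_pos ?_ (by linarith)
      have h3 : |c * expect p (u a)| ≤ c * U := by
        rw [abs_mul, abs_of_nonneg hc0]; exact mul_le_mul_of_nonneg_left (hvU a) hc0
      nlinarith [(abs_le.1 h3).1, sq_nonneg (expect p (w a)), sq_nonneg B]
  have hval_le : ∀ r a, expect p (quadraticScore u w γ κ B c K r a) ≤ val a := fun r a => by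
    by_cases h : r = truthfulReport X p a
    · rw [h, hval_truth]
    · exact (hval_lt r a h).le
  have hval_mono : ∀ a b, expect p (u a) ≤ expect p (u b) →
      expect p (u b) - expect p (u a) ≤ 2 * K * (val b - val a) := fun a b hab => by
    have h1 : 2 * K * (val b - val a) = (expect p (u b) - expect p (u a)) *
        (l * (expect p (w a) + expect p (w b)) + c) := by
      simp only [hval]
      field_simp
      rw [hwp, hwp]
      ring
    have h2 : |l * (expect p (w a) + expect p (w b))| ≤ |l| * (2 * B) := by
      rw [abs_mul]
      refine mul_le_mul_of_nonneg_left ((abs_add_le _ _).trans ?_) (abs_nonneg l)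
      linarith [hwB a, hwB b]
    rw [h1]
    exact le_mul_of_one_le_right (sub_nonneg.2 hab) (by linarith [(abs_le.1 h2).1])
  ext ⟨r, a⟩
  constructor
  · intro h
    obtain ⟨b, hb⟩ := exists_mem_optimalActions u p
    have h1 := h (truthfulReport X p b, b)
    simp only [hval_truth] at h1
    have h2 := hval_mono a b (hb a)
    have h3 := hval_le r a
    have h4 : expect p (u b) ≤ expect p (u a) := by nlinarith
    refine ⟨fun b' => (hb b').trans h4, ?_⟩
    by_contra hr
    have h5 := hval_lt r a hr
    have h6 := hb a
    nlinarith
  · rintro ⟨ha, hr⟩ ⟨r', a'⟩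
    simp only at ha hr
    subst hr
    simp only [hval_truth]
    refine (hval_le r' a').trans ?_
    have h1 := hval_mono a' a (ha a')
    have h2 := ha a'
    by_contra h3
    nlinarith

end Sufficiency

/-! ### Necessity: indifference segments -/

section Necessity

variable {A Θ : Type*} [Fintype Θ]

/-- Along a segment of beliefs on which `a` and `b` stay optimal, the truthful answer at `a` cannot
vary if the truthful answer at `b` does not. -/
theorem truthfulReport_eq_of_isIncentivizable {m : ℕ} {u : A → Θ → ℝ}
    {X : A → Matrix (Fin m) Θ ℝ} (hX : IsIncentivizable u X) {a b : A} {p e : Θ → ℝ}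
    (hS : ∀ i ∈ ({0, 1, -1} : Set ℝ), p + i • e ∈ stdSimplex ℝ Θ ∧
      a ∈ optimalActions u (p + i • e) ∧ b ∈ optimalActions u (p + i • e))
    (hb : truthfulReport X e b = 0) : truthfulReport X e a = 0 := by
  obtain ⟨V, -, hV⟩ := hX
  by_contra ha
  have hrep : ∀ (c : A) (i : ℝ), truthfulReport X (p + i • e) c =
      truthfulReport X p c + i • truthfulReport X e c := fun c i => by
    funext j
    simp [truthfulReport, expect_eq_dotProduct]
  have hopt : ∀ i ∈ ({0, 1, -1} : Set ℝ), ∀ c, c ∈ optimalActions u (p + i • e) →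
      (truthfulReport X p c + i • truthfulReport X e c, c) ∈ optimalResponses V (p + i • e) :=
    fun i hi c hc => by
      rw [hV _ (hS i hi).1]
      exact ⟨hc, (hrep c i).symm⟩
  have hA := fun i hi => hopt i hi a (hS i hi).2.1
  have hB := fun i hi => hopt i hi b (hS i hi).2.2
  -- Freeze the payments `F`, `G` of the truthful responses at the midpoint `p`. `G` stays optimal
  -- at both ends, whereas `F` is no longer truthful there and is strictly worse. The affine
  -- function `𝔼 F - 𝔼 G` would then be negative at both ends but nonnegative at the midpoint.
  set F := V (truthfulReport X p a) a with hF
  set G := V (truthfulReport X p b) b with hG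
  have hGopt : ∀ i ∈ ({0, 1, -1} : Set ℝ), ∀ y : (Fin m → ℝ) × A,
      expect (p + i • e) (V y.1 y.2) ≤ expect (p + i • e) G := fun i hi y => by
    simpa [hb] using hB i hi y
  have h0 : expect (p + (0 : ℝ) • e) G ≤ expect (p + (0 : ℝ) • e) F := by
    simpa using hA 0 (by simp) (truthfulReport X p b, b)
  have hlt : ∀ i ∈ ({0, 1, -1} : Set ℝ), i ≠ 0 →
      expect (p + i • e) F < expect (p + i • e) G := fun i hi hi0 => by
    by_contra hle
    rw [not_lt] at hle
    have hmem : (truthfulReport X p a, a) ∈ optimalResponses V (p + i • e) :=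
      fun y => (hGopt i hi y).trans hle
    rw [hV _ (hS i hi).1] at hmem
    have h := hmem.2
    simp only [hrep] at h
    exact (smul_ne_zero hi0 ha) (by simpa using h.symm)
  have h1 := hlt 1 (by simp) one_ne_zero
  have h2 := hlt (-1) (by simp) (by norm_num)
  simp only [expect_eq_dotProduct, add_dotProduct, smul_dotProduct, smul_eq_mul] at h0 h1 h2
  linarith

/-- The full-support beliefs under which every action other than `a` and `b` is worse than `a`. -/
def pairRegion (u : A → Θ → ℝ) (a b : A) : Set (Θ → ℝ) :=
  {p | (∀ θ, 0 < p θ) ∧ ∀ c, c ≠ a → c ≠ b → expect p (u c) < expect p (u a)}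

theorem isOpen_pairRegion [Finite A] (u : A → Θ → ℝ) (a b : A) : IsOpen (pairRegion u a b) := by
  simp only [pairRegion, Set.ofPred_and, Set.ofPred_forall]
  refine IsOpen.inter (isOpen_iInter_of_finite fun θ => ?_) (isOpen_iInter_of_finite fun c =>
    isOpen_iInter_of_finite fun _ => isOpen_iInter_of_finite fun _ => ?_)
  · exact isOpen_lt continuous_const (continuous_apply θ)
  · exact isOpen_lt (continuous_expect_left _) (continuous_expect_left _)

theorem mem_optimalActions_of_mem_pairRegion {u : A → Θ → ℝ} {a b : A} {p : Θ → ℝ}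
    (hp : p ∈ pairRegion u a b) (hab : expect p (u a) = expect p (u b)) :
    a ∈ optimalActions u p ∧ b ∈ optimalActions u p := by
  have ha : a ∈ optimalActions u p := fun c => by
    by_cases hca : c = a
    · rw [hca]
    by_cases hcb : c = b
    · rw [hcb, hab]
    exact (hp.2 c hca hcb).le
  exact ⟨ha, fun c => (ha c).trans hab.le⟩

theorem expect_lt_of_optimalActions_eq_pair {u : A → Θ → ℝ} {a b c : A} {p : Θ → ℝ}
    (hp : optimalActions u p = {a, b}) (hca : c ≠ a) (hcb : c ≠ b) :
    expect p (u c) < expect p (u a) := by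
  have ha : a ∈ optimalActions u p := by rw [hp]; simp
  refine lt_of_le_of_ne (ha c) fun h => ?_
  have hc : c ∈ optimalActions u p := fun y => (ha y).trans h.ge
  rw [hp] at hc
  rcases hc with h | h
  exacts [hca h, hcb h]

/-- If `v` has negative expectation under some belief and nonnegative expectation under one with full
support, it has expectation zero under some belief with full support. -/
theorem exists_pos_indifferent {v : Θ → ℝ} {p q : Θ → ℝ} (hp : p ∈ stdSimplex ℝ Θ)
    (hq : q ∈ stdSimplex ℝ Θ) (hq0 : ∀ θ, 0 < q θ) (hpv : expect p v < 0) (hqv : 0 ≤ expect q v) :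
    ∃ r ∈ stdSimplex ℝ Θ, (∀ θ, 0 < r θ) ∧ expect r v = 0 := by
  have hd : 0 < expect q v - expect p v := by linarith
  -- Weights at which the affine interpolation of the two expectations vanishes; `s > 0` transfers
  -- the full support of `q`.
  set s := -expect p v / (expect q v - expect p v) with hs
  set s' := expect q v / (expect q v - expect p v) with hs'
  have hs0 : 0 < s := div_pos (by linarith) hd
  have hs0' : 0 ≤ s' := div_nonneg hqv hd.le
  have hsum : s + s' = 1 := by rw [hs, hs']; field_simp; ring
  refine ⟨s • q + s' • p, convex_stdSimplex ℝ Θ hq hp hs0.le hs0' hsum, fun θ => ?_, ?_⟩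
  · exact add_pos_of_pos_of_nonneg (mul_pos hs0 (hq0 θ)) (mul_nonneg hs0' (hp.1 θ))
  · rw [expect_eq_dotProduct, add_dotProduct, smul_dotProduct, smul_dotProduct,
      ← expect_eq_dotProduct, ← expect_eq_dotProduct, smul_eq_mul, smul_eq_mul, hs, hs']
    field_simp
    ring

/-- If all pairs of at least three actions are adjacent, any two of them are the only optimal
actions under some belief with full support. -/
theorem exists_mem_pairRegion [Finite A] {u : A → Θ → ℝ} (hu : adjacencyGraph u = ⊤)
    {a b c : A} (hab : a ≠ b) (hca : c ≠ a) (hcb : c ≠ b) :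
    ∃ p ∈ stdSimplex ℝ Θ, p ∈ pairRegion u a b ∧ expect p (u a) = expect p (u b) := by
  have hadj : ∀ x y : A, x ≠ y → ∃ p ∈ stdSimplex ℝ Θ, optimalActions u p = {x, y} :=
    fun x y hxy => by
      have h : (adjacencyGraph u).Adj x y := by rw [hu]; exact hxy
      exact h.2
  obtain ⟨p, hp, hpo⟩ := hadj a b hab
  -- The third action `c` yields beliefs with `a` strictly above `b` and vice versa. Mixing the
  -- suitable one with the uniform belief gives a full-support `q` indifferent between `a` and `b`.
  obtain ⟨pa, hpa, hpao⟩ := hadj a c hca.symm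
  obtain ⟨pb, hpb, hpbo⟩ := hadj b c hcb.symm
  have hva := expect_lt_of_optimalActions_eq_pair hpao hab.symm hcb.symm
  have hvb := expect_lt_of_optimalActions_eq_pair hpbo hab hca.symm
  have hne : Nonempty Θ := by
    by_contra h
    rw [not_nonempty_iff] at h
    simpa using hp.2
  have hcard : 0 < (Fintype.card Θ : ℝ) := by exact_mod_cast Fintype.card_pos
  let q0 : Θ → ℝ := fun _ => (Fintype.card Θ : ℝ)⁻¹
  have hq0pos : ∀ θ, 0 < q0 θ := fun _ => inv_pos.2 hcard
  have hq0 : q0 ∈ stdSimplex ℝ Θ := ⟨fun θ => (hq0pos θ).le, by simp [q0, hcard.ne']⟩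
  have hsub : ∀ r x y, expect r (u x - u y) = expect r (u x) - expect r (u y) := fun r x y => by
    simp [expect_eq_dotProduct]
  obtain ⟨q, hq, hqpos, hqab⟩ : ∃ q ∈ stdSimplex ℝ Θ, (∀ θ, 0 < q θ) ∧
      expect q (u a) = expect q (u b) := by
    rcases le_total (expect q0 (u a)) (expect q0 (u b)) with h | h
    · obtain ⟨r, hr, hr0, hrv⟩ := exists_pos_indifferent (v := u b - u a) hpa hq0 hq0pos
        (by rw [hsub]; linarith) (by rw [hsub]; linarith)
      rw [hsub] at hrv
      exact ⟨r, hr, hr0, by linarith⟩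
    · obtain ⟨r, hr, hr0, hrv⟩ := exists_pos_indifferent (v := u a - u b) hpb hq0 hq0pos
        (by rw [hsub]; linarith) (by rw [hsub]; linarith)
      rw [hsub] at hrv
      exact ⟨r, hr, hr0, by linarith⟩
  have hpab : expect p (u a) = expect p (u b) := by
    have ha : a ∈ optimalActions u p := by rw [hpo]; simp
    have hb : b ∈ optimalActions u p := by rw [hpo]; simp
    exact le_antisymm (hb a) (ha b)
  -- A small move from `p` towards `q` gains full support, keeps the indifference by linearity and
  -- keeps the strict inequalities by openness.
  let f : ℝ → Θ → ℝ := fun ε => (1 - ε) • p + ε • q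
  have hf : Continuous f := by fun_prop
  have hopen : IsOpen {r : Θ → ℝ | ∀ x, x ≠ a → x ≠ b → expect r (u x) < expect r (u a)} := by
    simp only [Set.ofPred_forall]
    exact isOpen_iInter_of_finite fun x => isOpen_iInter_of_finite fun _ =>
      isOpen_iInter_of_finite fun _ =>
        isOpen_lt (continuous_expect_left _) (continuous_expect_left _)
  have hnhds := (hopen.preimage hf).mem_nhds (x := 0) (by
    intro x hxa hxb
    simpa [f] using expect_lt_of_optimalActions_eq_pair hpo hxa hxb)
  obtain ⟨δ, hδ, hball⟩ := Metric.mem_nhds_iff.1 hnhds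
  set ε := min (δ / 2) 1 with hε
  have hε0 : 0 < ε := lt_min (by linarith) one_pos
  have hε1 : 0 ≤ 1 - ε := sub_nonneg.2 (min_le_right _ _)
  have hεδ : ε < δ := (min_le_left _ _).trans_lt (by linarith)
  refine ⟨f ε, convex_stdSimplex ℝ Θ hp hq hε1 hε0.le (by ring), ⟨fun θ => ?_, ?_⟩, ?_⟩
  · exact add_pos_of_nonneg_of_pos (mul_nonneg hε1 (hp.1 θ)) (mul_pos hε0 (hqpos θ))
  · exact hball (by simpa [abs_of_pos hε0] using hεδ)
  · simp only [expect_eq_dotProduct] at hpab hqab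
    simp [f, expect_eq_dotProduct, hpab, hqab]

/-- For adjacent actions, if the question at `b` is trivial, then the question at `a` is determined
by the payoff difference up to a constant. -/
theorem expect_eq_zero_of_isIncentivizable [Finite A] {u : A → Θ → ℝ}
    {X : A → Matrix (Fin 1) Θ ℝ} (hX : IsIncentivizable u X) {a b : A} {p : Θ → ℝ}
    (hp : p ∈ stdSimplex ℝ Θ) (hpr : p ∈ pairRegion u a b)
    (hpab : expect p (u a) = expect p (u b)) (hXb : X b = 0) {e : Θ → ℝ}
    (he : ∑ θ, e θ = 0) (heD : expect e (u b - u a) = 0) : expect e (X a 0) = 0 := by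
  let f : ℝ → Θ → ℝ := fun ε => p + ε • e
  have hf : Continuous f := by fun_prop
  have hnhds := ((isOpen_pairRegion u a b).preimage hf).mem_nhds (x := 0) (by simpa [f] using hpr)
  obtain ⟨δ, hδ, hball⟩ := Metric.mem_nhds_iff.1 hnhds
  have hmem : ∀ x : ℝ, |x| < δ → f x ∈ stdSimplex ℝ Θ ∧
      a ∈ optimalActions u (f x) ∧ b ∈ optimalActions u (f x) := fun x hx => by
    have hr : f x ∈ pairRegion u a b := hball (by simpa using hx)
    refine ⟨⟨fun θ => (hr.1 θ).le, ?_⟩, mem_optimalActions_of_mem_pairRegion hr ?_⟩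
    · simp [f, Finset.sum_add_distrib, ← Finset.mul_sum, he, hp.2]
    · simp only [expect_eq_dotProduct, dotProduct_sub] at heD hpab
      simp only [f, expect_eq_dotProduct, add_dotProduct, smul_dotProduct, hpab,
        sub_eq_zero.1 heD]
  have h := truthfulReport_eq_of_isIncentivizable hX (a := a) (b := b) (p := p)
    (e := (δ / 2) • e) (fun i hi => by
      rw [smul_smul]
      refine hmem _ ?_
      have hδ2 : |δ / 2| < δ := by rw [abs_of_pos (by linarith)]; linarith
      rcases hi with rfl | rfl | rfl
      · simpa using hδ
      · simpa using hδ2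
      · simpa [abs_neg] using hδ2)
    (by funext j; simp [truthfulReport, hXb, expect])
  have h0 := congrFun h 0
  simp only [truthfulReport, expect_eq_dotProduct, smul_dotProduct, smul_eq_mul,
    Pi.zero_apply, mul_eq_zero] at h0
  exact h0.resolve_left (by linarith)

end Necessity

/-! ### One-dimensional reports and centered payoffs -/

section Scalar

theorem isUnit_fin_one_iff {M : Matrix (Fin 1) (Fin 1) ℝ} : IsUnit M ↔ M 0 0 ≠ 0 := by
  rw [Matrix.isUnit_iff_isUnit_det, Matrix.det_fin_one, isUnit_iff_ne_zero]

theorem mul_apply_fin_one {Θ : Type*} (M : Matrix (Fin 1) (Fin 1) ℝ) (t : Matrix (Fin 1) Θ ℝ)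
    (θ : Θ) : (M * t) 0 θ = M 0 0 * t 0 θ := by
  simp [Matrix.mul_apply]

/-- Centering kills constants, so a relation modulo `𝟏` becomes one to which linear independence
applies. -/
theorem payoffDiff_eq_zero_of_combination_const {A Θ : Type*} [Fintype Θ] {u : A → Θ → ℝ}
    {a b c : A} {x y k : ℝ}
    (h : ∀ θ, x * (u b θ - u a θ) + y * (u c θ - u a θ) = k) :
    x • payoffDiff u a b + y • payoffDiff u a c = 0 := by
  funext θ
  have hcard : (Fintype.card Θ : ℝ) ≠ 0 := by
    exact_mod_cast (Fintype.card_pos_iff.2 ⟨θ⟩).ne'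
  have hsum : x * (∑ θ, u b θ - ∑ θ, u a θ) + y * (∑ θ, u c θ - ∑ θ, u a θ)
      = Fintype.card Θ * k := by
    have := Finset.sum_congr (rfl : (Finset.univ : Finset Θ) = Finset.univ) fun θ _ => h θ
    simpa [Finset.sum_add_distrib, ← Finset.mul_sum] using this
  simp only [payoffDiff, centered, Pi.add_apply, Pi.smul_apply, Pi.sub_apply, smul_eq_mul,
    Pi.zero_apply]
  have h' := h θ
  field_simp
  linear_combination (Fintype.card Θ : ℝ) * h' - hsum

end Scalar

/-! ### The two implications -/

theorem isRobustlyIncentivizable_of_isAligned {A Θ : Type*} [Finite A] [Nonempty A] [Fintype Θ]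
    {u : A → Θ → ℝ} {X : A → Matrix (Fin 1) Θ ℝ} (h : IsAligned u X) :
    IsRobustlyIncentivizable u X := by
  obtain ⟨l, d, Γ, κ, h⟩ := h
  refine ⟨Γ, fun a => (h a).1, fun t => ?_⟩
  refine isIncentivizable_of_eq_smul_add (l := l 0) (d := fun θ => d 0 θ + t 0 θ)
    (γ := fun a => Γ a 0 0) (κ := fun a => κ a 0) (fun a => isUnit_fin_one_iff.1 (h a).1)
    fun a θ => ?_
  rw [Matrix.add_apply, mul_apply_fin_one, (h a).2, Matrix.add_apply, mul_apply_fin_one]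
  simp only [Matrix.add_apply, Matrix.vecMulVec_apply]
  ring

/-- Robustness enters here: the shift `t = -X(b)/μ(b)` trivializes the question at `b` and leaves
`μ(a) (X(a)/μ(a) - X(b)/μ(b))` at `a`. -/
theorem exists_sub_eq_of_isRobustlyIncentivizable {A Θ : Type*} [Finite A] [Fintype Θ]
    {u : A → Θ → ℝ} (hu : adjacencyGraph u = ⊤) {X : A → Matrix (Fin 1) Θ ℝ}
    {μ : A → ℝ} (hμ : ∀ a, μ a ≠ 0)
    (hX : ∀ t : Θ → ℝ, IsIncentivizable u fun a => Matrix.of fun i θ => X a i θ + μ a * t θ)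
    {a b c : A} (hab : a ≠ b) (hca : c ≠ a) (hcb : c ≠ b) :
    ∃ k l : ℝ, ∀ θ, X b 0 θ / μ b - X a 0 θ / μ a = k + l * (u b θ - u a θ) := by
  obtain ⟨p, hp, hpr, hpab⟩ := exists_mem_pairRegion hu hab hca hcb
  refine exists_eq_const_add_smul (D := u b - u a)
    (y := fun θ => X b 0 θ / μ b - X a 0 θ / μ a) fun e he heD => ?_
  have h := expect_eq_zero_of_isIncentivizable (hX fun θ => -(X b 0 θ / μ b)) hp hpr hpab (by
    ext i θ
    rw [Subsingleton.elim i 0]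
    simp [mul_div_cancel₀ _ (hμ b)]) he heD
  have h1 : (fun θ => X b 0 θ / μ b - X a 0 θ / μ a) = (-(μ a)⁻¹) •
      (Matrix.of fun (i : Fin 1) θ => X a i θ + μ a * -(X b 0 θ / μ b)) 0 := by
    funext θ
    have := hμ a
    simp only [Pi.smul_apply, Matrix.of_apply, smul_eq_mul]
    field_simp
    ring
  rw [expect_eq_dotProduct] at h
  rw [h1, expect_eq_dotProduct, dotProduct_smul, h, smul_zero]

theorem isAligned_of_isRobustlyIncentivizable {A Θ : Type*} [Fintype A] [Fintype Θ] {u : A → Θ → ℝ}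
    {X : A → Matrix (Fin 1) Θ ℝ} (hcomplete : adjacencyGraph u = ⊤)
    (hcard : 4 ≤ Fintype.card A)
    (hindep : ∀ (a : A) (b : Fin 3 → A), Function.Injective b → (∀ i, b i ≠ a) →
      LinearIndependent ℝ (fun i => payoffDiff u a (b i)))
    (h : IsRobustlyIncentivizable u X) : IsAligned u X := by
  classical
  obtain ⟨μ, hμ, hX⟩ := h
  have hμ0 : ∀ a, μ a 0 0 ≠ 0 := fun a => isUnit_fin_one_iff.1 (hμ a)
  have hX' : ∀ t : Θ → ℝ, IsIncentivizable u
      fun a => Matrix.of fun i θ => X a i θ + μ a 0 0 * t θ := fun t => by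
    convert hX (Matrix.of fun _ => t) using 2 with a
    ext i θ
    rw [Subsingleton.elim i 0, Matrix.add_apply, mul_apply_fin_one]
    rfl
  have hthird : ∀ s : Finset A, s.card ≤ 3 → ∃ c, c ∉ s := fun s hs => by
    by_contra! hall
    have : s = Finset.univ := Finset.eq_univ_iff_forall.2 hall
    rw [this, Finset.card_univ] at hs
    omega
  have hpair : ∀ a b : A, a ≠ b → ∃ k l : ℝ, ∀ θ,
      X b 0 θ / μ b 0 0 - X a 0 θ / μ a 0 0 = k + l * (u b θ - u a θ) := fun a b hab => by
    obtain ⟨c, hc⟩ := hthird {a, b} (Finset.card_le_two.trans (by norm_num))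
    simp only [Finset.mem_insert, Finset.mem_singleton, not_or] at hc
    exact exists_sub_eq_of_isRobustlyIncentivizable hcomplete hμ0 hX' hab hc.1 hc.2
  obtain ⟨a, -⟩ := hthird ∅ (by simp)
  obtain ⟨b, hb⟩ := hthird {a} (by simp)
  rw [Finset.mem_singleton] at hb
  obtain ⟨k, l, hkl⟩ := hpair a b (Ne.symm hb)
  have hcommon : ∀ c, ∃ k' : ℝ, ∀ θ,
      X c 0 θ / μ c 0 0 - X a 0 θ / μ a 0 0 = k' + l * (u c θ - u a θ) := fun c => by
    by_cases hca : c = a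
    · exact ⟨0, fun θ => by simp [hca]⟩
    by_cases hcb : c = b
    · exact ⟨k, fun θ => by rw [hcb]; exact hkl θ⟩
    obtain ⟨k₁, l₁, h₁⟩ := hpair a c (Ne.symm hca)
    obtain ⟨k₂, l₂, h₂⟩ := hpair b c (Ne.symm hcb)
    -- `d` only completes a triple for `hindep`; its coefficient below is 0.
    obtain ⟨d, hd⟩ := hthird {a, b, c} Finset.card_le_three
    simp only [Finset.mem_insert, Finset.mem_singleton, not_or] at hd
    obtain ⟨hda, hdb, hdc⟩ := hd
    have hli := hindep a ![b, c, d]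
      (by
        intro i j hij
        fin_cases i <;> fin_cases j <;> simp_all [eq_comm])
      (by intro i; fin_cases i <;> assumption)
    -- The difference along `a`, `c` is the sum of those along `a`, `b` and `b`, `c`, rewritten with
    -- base point `a`.
    have hz := payoffDiff_eq_zero_of_combination_const (u := u) (a := a) (b := b) (c := c)
      (x := l - l₂) (y := l₂ - l₁) (k := k₁ - k - k₂) fun θ => by
        linear_combination h₁ θ - hkl θ - h₂ θ
    have hli' := Fintype.linearIndependent_iff.1 hli ![l - l₂, l₂ - l₁, 0] (by
      simpa [Fin.sum_univ_three] using hz)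
    have e0 : l - l₂ = 0 := hli' 0
    have e1 : l₂ - l₁ = 0 := hli' 1
    have e2 : l₁ = l := by linarith
    exact ⟨k₁, fun θ => by rw [h₁, e2]⟩
  choose κ hκ using hcommon
  -- By `hκ`, `X(c)/μ(c) - l u(c)` agrees with its value at `a` up to a constant; that value serves
  -- as `d`.
  refine ⟨fun _ => l, Matrix.of fun _ θ => X a 0 θ / μ a 0 0 - l * u a θ, μ,
    fun c _ => μ c 0 0 * κ c, fun c => ⟨hμ c, ?_⟩⟩
  ext i θ
  rw [Subsingleton.elim i 0, Matrix.add_apply, mul_apply_fin_one]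
  simp only [Matrix.add_apply, Matrix.vecMulVec_apply, Matrix.of_apply, mul_one]
  have h1 : X c 0 θ = μ c 0 0 * (X c 0 θ / μ c 0 0) := (mul_div_cancel₀ _ (hμ0 c)).symm
  rw [h1]
  linear_combination μ c 0 0 * hκ c θ

theorem mainTheorem10 {A Θ : Type*} [Fintype A] [Fintype Θ] (u : A → Θ → ℝ)
    (X : A → Matrix (Fin 1) Θ ℝ)
    (hcomplete : adjacencyGraph u = ⊤)
    (hcard : 4 ≤ Fintype.card A)
    (hindep : ∀ (a : A) (b : Fin 3 → A), Function.Injective b → (∀ i, b i ≠ a) →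
      LinearIndependent ℝ (fun i => payoffDiff u a (b i))) :
    IsRobustlyIncentivizable u X ↔ IsAligned u X := by
  have : Nonempty A := Fintype.card_pos_iff.1 (by omega)
  exact ⟨isAligned_of_isRobustlyIncentivizable hcomplete hcard hindep,
    isRobustlyIncentivizable_of_isAligned⟩
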